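/- Let $S$ be a hyperbolic space, i.e. a geodesic metric space (not necessarily proper) for which there is $\delta\ge 0$ such that every side of every geodesic triangle lies in the $\delta$-neighbourhood of the union of the other two sides. Let $\partial S$ be its Gromov boundary (equivalence classes of sequences converging at infinity), and equip $S\cup\partial S$ with its usual topology. For a group $K$ acting on $S$ by isometries let $\Lambda(K)=\overline{Ks}\cap\partial S$ be the limit set, where $s\in S$ and the closure is taken in $S\cup\partial S$ (it does not depend on $s$). The action of $K$ is \emph{of general type} if $\Lambda(K)$ is infinite and $K$ fixes no point of $\partial S$; it is \emph{elliptic} if all orbits of $K$ in $S$ are bounded. Let $G$ be a countable group with an isometric action of general type on $S$. Put $E(G)=\{g\in G\mid gx=x\ \ \forall x\in\Lambda(G)\}$ (the elliptic radical). A subgroup $H\le G$ is \emph{geometrically dense} if $H$ fixes no point of $\partial S$ and $\Lambda(H)=\Lambda(G)$. A subgroup $H\le G$ is \emph{recurrent} if for every $g\in G$ and every open neighbourhood $\mathcal U$ of $H$ in the space $\mathrm{Sub}(G)$ of subgroups of $G$ (with the topology induced by the product topology on $\{0,1\}^G$) there are infinitely many $n\in\mathbb N$ with $g^nHg^{-n}\in\mathcal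 U$. Then every recurrent subgroup $H$ of $G$ is geometrically dense or contained in $E(G)$. Moreover, if $H$ is geometrically dense, then the action of $H$ on $S$ is of general type, and if $H\le E(G)$, then $H$ is elliptic. -/

import Mathlib

open Filter Topology

noncomputable section

namespace HypAction

/-! ### Hyperbolic metric spaces -/

section Hyperbolic

variable {S : Type*} [MetricSpace S]

/-- `A` is (the image of) a geodesic segment from `x` to `y`. -/
def IsGeodesicSegment (x y : S) (A : Set S) : Prop :=
  ∃ γ : ℝ → S, γ 0 = x ∧ γ (dist x y) = y ∧
    (∀ a ∈ Set.Icc 0 (dist x y), ∀ b ∈ Set.Icc 0 (dist x y), dist (γ a) (γ b) = |a - b|) ∧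
    A = γ '' Set.Icc 0 (dist x y)

/-- Every side of every geodesic triangle lies in the closed `δ`-neighbourhood of the union of
the two other sides. -/
def HasSlimTriangles (S : Type*) [MetricSpace S] (δ : ℝ) : Prop :=
  ∀ (x y z : S) (A B C : Set S), IsGeodesicSegment x y A → IsGeodesicSegment y z B →
    IsGeodesicSegment z x C → ∀ p ∈ A, ∃ q ∈ B ∪ C, dist p q ≤ δ

/-- A hyperbolic space: a geodesic metric space with uniformly slim triangles (no properness
or completeness is required). -/
structure IsHyperbolicSpace (S : Type*) [MetricSpace S] : Prop where
  geodesic : ∀ x y : S, ∃ A : Set S, IsGeodesicSegment x y A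
  slim : ∃ δ : ℝ, 0 ≤ δ ∧ HasSlimTriangles S δ

/-- The Gromov product `(x, y)_s`. -/
def gromovProduct (s x y : S) : ℝ :=
  (dist x s + dist y s - dist x y) / 2

/-- `(x_i, y_j)_s → ∞` as `i, j → ∞` (for every base point `s`). -/
def AsymptoticSeq (x y : ℕ → S) : Prop :=
  ∀ s : S, Tendsto (fun p : ℕ × ℕ => gromovProduct s (x p.1) (y p.2)) atTop atTop

/-- Sequences that converge at infinity. -/
def SeqAtInfinity (S : Type*) [MetricSpace S] : Type _ :=
  {x : ℕ → S // AsymptoticSeq x x}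

/-- The Gromov boundary: sequences converging at infinity up to equivalence. The relation
divided out is an equivalence relation when `S` is hyperbolic. -/
def GromovBoundary (S : Type*) [MetricSpace S] : Type _ :=
  Quot (fun x y : SeqAtInfinity S => AsymptoticSeq x.1 y.1)

/-- The space `S ∪ ∂S`. -/
def Bordification (S : Type*) [MetricSpace S] : Type _ :=
  S ⊕ GromovBoundary S

/-- The inclusion of `S` in `S ∪ ∂S`. -/
def ofPoint (x : S) : Bordification S := Sum.inl x

/-- The inclusion of `∂S` in `S ∪ ∂S`. -/
def ofBoundary (ξ : GromovBoundary S) : Bordification S := Sum.inr ξ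

/-- The sequence `x` of points of `S` converges to the boundary point `ξ`, that is, it converges
at infinity and its class is `ξ`. -/
def ConvergesToBoundary (x : ℕ → S) (ξ : GromovBoundary S) : Prop :=
  ∃ hx : AsymptoticSeq x x, (Quot.mk _ ⟨x, hx⟩ : GromovBoundary S) = ξ

/-- Convergence of a sequence of points of `S` to a point of `S ∪ ∂S`. -/
def ConvergesTo (x : ℕ → S) : Bordification S → Prop
  | Sum.inl y => Tendsto x atTop (𝓝 y)
  | Sum.inr ξ => ConvergesToBoundary x ξ

/-- The basic neighbourhood of `ξ ∈ ∂S` in `S ∪ ∂S`: the points `p` whose Gromov product with `ξ`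
is at least `R`, i.e. `(x_i, y_j)_s ≥ R` for all large `i, j`, for some sequences `x_i → ξ` and
`y_j → p`. -/
def boundaryNhd (s : S) (R : ℝ) (ξ : GromovBoundary S) : Set (Bordification S) :=
  {p | ∃ x y : ℕ → S, ConvergesToBoundary x ξ ∧ ConvergesTo y p ∧
    ∀ᶠ ij : ℕ × ℕ in atTop, R ≤ gromovProduct s (x ij.1) (y ij.2)}

theorem boundaryNhd_anti (s : S) {R R' : ℝ} (h : R ≤ R') (ξ : GromovBoundary S) :
    boundaryNhd s R' ξ ⊆ boundaryNhd s R ξ := by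
  rintro p ⟨x, y, hx, hy, hxy⟩
  exact ⟨x, y, hx, hy, hxy.mono fun _ hij => h.trans hij⟩

/-- The topology of `S ∪ ∂S`: it restricts to the metric topology on the open subset `S`, and the
sets `boundaryNhd s R ξ`, `R ∈ ℝ`, form a neighbourhood base at `ξ ∈ ∂S`. -/
instance bordificationTopology : TopologicalSpace (Bordification S) where
  IsOpen U := IsOpen (ofPoint ⁻¹' U) ∧
    ∀ ξ : GromovBoundary S, ofBoundary ξ ∈ U → ∀ s : S, ∃ R : ℝ, boundaryNhd s R ξ ⊆ U
  isOpen_univ := ⟨isOpen_univ, fun _ _ _ => ⟨0, Set.subset_univ _⟩⟩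
  isOpen_inter := by
    rintro U V ⟨hU, hU'⟩ ⟨hV, hV'⟩
    refine ⟨hU.inter hV, fun ξ hξ s => ?_⟩
    obtain ⟨R, hR⟩ := hU' ξ hξ.1 s
    obtain ⟨R', hR'⟩ := hV' ξ hξ.2 s
    exact ⟨max R R', Set.subset_inter ((boundaryNhd_anti s (le_max_left _ _) ξ).trans hR)
      ((boundaryNhd_anti s (le_max_right _ _) ξ).trans hR')⟩
  isOpen_sUnion := by
    intro 𝒰 h𝒰
    refine ⟨?_, ?_⟩
    · rw [Set.preimage_sUnion]
      exact isOpen_biUnion fun U hU => (h𝒰 U hU).1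
    · rintro ξ ⟨U, hU, hξ⟩ s
      obtain ⟨R, hR⟩ := (h𝒰 U hU).2 ξ hξ s
      exact ⟨R, hR.trans (Set.subset_sUnion_of_mem hU)⟩

end Hyperbolic

/-! ### Isometric actions -/

section Action

variable (G : Type*) [Group G] (S : Type*) [MetricSpace S] [MulAction G S] [IsIsometricSMul G S]

/-- The restriction of an isometric action to a subgroup is isometric. -/
instance subgroupIsIsometricSMul (H : Subgroup G) : IsIsometricSMul H S :=
  ⟨fun h => isometry_smul S (h : G)⟩

variable {G S} in
theorem AsymptoticSeq.smul (g : G) {x y : ℕ → S} (h : AsymptoticSeq x y) :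
    AsymptoticSeq (fun i => g • x i) (fun i => g • y i) := by
  intro s
  have hs := h (g⁻¹ • s)
  have key : ∀ a b : S, gromovProduct s (g • a) (g • b) = gromovProduct (g⁻¹ • s) a b := by
    intro a b
    have hd : ∀ c : S, dist (g • c) s = dist c (g⁻¹ • s) := fun c => by
      rw [← dist_smul g c (g⁻¹ • s), smul_inv_smul]
    simp only [gromovProduct, hd, dist_smul]
  simpa only [key] using hs

/-- The action on `∂S` induced by the action on `S`: `g • lim x_i = lim (g • x_i)`. -/
instance boundaryAction : MulAction G (GromovBoundary S) where
  smul g := Quot.map (fun x : SeqAtInfinity S => ⟨fun i => g • x.1 i, AsymptoticSeq.smul g x.2⟩)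
    (fun _ _ h => AsymptoticSeq.smul g h)
  one_smul := by
    rintro ⟨x⟩
    exact congrArg (Quot.mk _) (Subtype.ext (funext fun i => one_smul G (x.1 i)))
  mul_smul := by
    rintro g h ⟨x⟩
    exact congrArg (Quot.mk _) (Subtype.ext (funext fun i => mul_smul g h (x.1 i)))

/-- The limit set `Λ(G)`: the boundary points in the closure, in `S ∪ ∂S`, of an orbit `Gs`
(for `S` hyperbolic this does not depend on `s`). -/
def limitSet : Set (GromovBoundary S) :=
  {ξ | ∃ s : S, ofBoundary ξ ∈ closure (ofPoint '' MulAction.orbit G s)}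

/-- The action of `G` on `S` is non-elementary: `Λ(G)` is infinite. -/
def IsNonElementary : Prop :=
  (limitSet G S).Infinite

/-- The action of `G` on `S` is of general type: it is non-elementary and no point of `∂S` is
fixed by `G`. -/
def IsGeneralType : Prop :=
  IsNonElementary G S ∧ ¬ ∃ ξ : GromovBoundary S, ∀ g : G, g • ξ = ξ

/-- The action of `G` on `S` is elliptic: it has bounded orbits. -/
def IsElliptic : Prop :=
  ∀ s : S, Bornology.IsBounded (MulAction.orbit G s)

/-- The elliptic radical `E(G)`: the elements of `G` that fix every point of `Λ(G)`. -/
def ellipticRadical : Subgroup G :=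
  fixingSubgroup G (limitSet G S)

variable {G} in
/-- `H ≤ G` is geometrically dense: it fixes no point of `∂S`, and `Λ(H) = Λ(G)`. -/
def IsGeometricallyDense (H : Subgroup G) : Prop :=
  (¬ ∃ ξ : GromovBoundary S, ∀ h ∈ H, h • ξ = ξ) ∧ limitSet H S = limitSet G S

end Action

/-! ### Recurrent subgroups -/

section Recurrent

variable {G : Type*} [Group G]

open Classical in
/-- The topology on `Sub(G)` induced by the product topology on `{0,1}^G`, where each factor
`{0,1}` is discrete. -/
@[reducible]
def subgroupTopology (G : Type*) [Group G] : TopologicalSpace (Subgroup G) :=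
  TopologicalSpace.induced (fun (H : Subgroup G) (g : G) => decide (g ∈ H))
    (inferInstance : TopologicalSpace (G → Bool))

/-- The conjugate `g H g⁻¹`. -/
def conjSubgroup (g : G) (H : Subgroup G) : Subgroup G :=
  H.map (MulAut.conj g).toMonoidHom

/-- `H` is recurrent: for every `g ∈ G` and every open neighbourhood `U` of `H` in `Sub(G)`,
there are infinitely many `n ∈ ℕ` with `g ^ n H g ^ (-n) ∈ U`. -/
def IsRecurrentSubgroup (H : Subgroup G) : Prop :=
  ∀ (g : G) (U : Set (Subgroup G)), IsOpen[subgroupTopology G] U → H ∈ U →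
    {n : ℕ | conjSubgroup (g ^ n) H ∈ U}.Infinite

end Recurrent

end HypAction

end

namespace HypAction

section Hyperbolic

variable {S : Type*} [MetricSpace S]

/-! ### The Gromov product -/

/-! Suppose some `h ∈ H` moves a point `ξ` of `Λ(G)`. The subgroups containing `h` form an open
neighbourhood of `H`, so for every `g` recurrence gives `n ≥ 1` with `g⁻ⁿ h gⁿ ∈ H`
(`exists_conj_mem`). General type supplies `g` whose positive powers all send `s` near one
prescribed limit point and whose negative powers all send it near another (`exists_near_pow`), so
the lack of control over `n` is harmless.

Limit set: let positive powers go to a point moved by `h` and negative powers to a target `η`. Then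
`gⁿs` and `h gⁿs` have bounded Gromov product, and applying `g⁻ⁿ` (`gromovProduct_smul_smul`) puts
`g⁻ⁿ h gⁿ s` near `η`. Hence `η ∈ Λ(H)`.

Fixed points: if `H` fixes `η`, let positive powers go to `ξ` and negative powers to some `ζ ≠ η`.
Then `gⁿη` is near `ξ` and fixed by `h`, while `h` moves a neighbourhood of `ξ` off itself.

Ellipticity: if `h` has large displacement, a boundary point it fixes must lie in the direction of
`hs` or of `h⁻¹s`, which leaves no room for three such points.

Without properness there is no compactness; all arguments are estimates of Gromov products along
sequences, resting on the four-point condition. -/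

theorem gromovProduct_comm (s x y : S) : gromovProduct s x y = gromovProduct s y x := by
  simp only [gromovProduct, dist_comm x y]
  ring

theorem gromovProduct_self (s x : S) : gromovProduct s x x = dist s x := by
  simp only [gromovProduct, dist_self, dist_comm x s]
  ring

theorem gromovProduct_nonneg (s x y : S) : 0 ≤ gromovProduct s x y := by
  have := dist_triangle_right x y s
  simp only [gromovProduct]
  linarith

theorem gromovProduct_le_dist_left (s x y : S) : gromovProduct s x y ≤ dist s x := by
  have := dist_triangle_left y s x
  simp only [gromovProduct, dist_comm s x]
  linarith

theorem gromovProduct_le_dist_right (s x y : S) : gromovProduct s x y ≤ dist s y := by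
  rw [gromovProduct_comm]
  exact gromovProduct_le_dist_left s y x

theorem gromovProduct_le_add_base (s t x y : S) :
    gromovProduct s x y ≤ gromovProduct t x y + dist s t := by
  have h₁ := dist_triangle_right x s t
  have h₂ := dist_triangle_right y s t
  simp only [gromovProduct]
  linarith

theorem gromovProduct_le_add_right (s x y z : S) :
    gromovProduct s x y ≤ gromovProduct s x z + dist y z := by
  have h₁ := dist_triangle y z s
  have h₂ := dist_triangle_right x z y
  simp only [gromovProduct]
  rw [dist_comm z y] at h₂
  linarith

/-- `(x, y)_s + (s, y)_x = d(s, x)`. -/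
theorem gromovProduct_add (s x y : S) :
    gromovProduct s x y + gromovProduct x s y = dist s x := by
  simp only [gromovProduct, dist_comm y s, dist_comm y x, dist_comm x s]
  ring

/-! ### The four-point condition -/

/-- Gromov's four-point condition with constant `δ ≥ 0`. -/
structure IsGromovHyperbolic (S : Type*) [MetricSpace S] (δ : ℝ) : Prop where
  nonneg : 0 ≤ δ
  four_point : ∀ s x y z : S,
    min (gromovProduct s x y) (gromovProduct s y z) - δ ≤ gromovProduct s x z

theorem IsGromovHyperbolic.le_trans {δ : ℝ} (hδ : IsGromovHyperbolic S δ) {s x y z : S} {R : ℝ}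
    (h₁ : R ≤ gromovProduct s x y) (h₂ : R ≤ gromovProduct s y z) :
    R - δ ≤ gromovProduct s x z := by
  have := hδ.four_point s x y z
  have := le_min h₁ h₂
  linarith

theorem IsGeodesicSegment.dist_add_dist {x y q : S} {A : Set S} (hA : IsGeodesicSegment x y A)
    (hq : q ∈ A) : dist x q + dist q y = dist x y := by
  obtain ⟨γ, h0, h1, hγ, rfl⟩ := hA
  obtain ⟨t, ht, rfl⟩ := hq
  have hx : dist x (γ t) = t := by
    rw [← h0, hγ 0 ⟨le_rfl, dist_nonneg⟩ t ht, zero_sub, abs_neg, abs_of_nonneg ht.1]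
  have hy : dist (γ t) y = dist x y - t := by
    have := hγ t ht (dist x y) ⟨dist_nonneg, le_rfl⟩
    rw [h1] at this
    rw [this, abs_sub_comm, abs_of_nonneg (sub_nonneg.2 ht.2)]
  rw [hx, hy]
  ring

theorem IsGeodesicSegment.left_mem {x y : S} {A : Set S} (hA : IsGeodesicSegment x y A) :
    x ∈ A := by
  obtain ⟨γ, h0, h1, hγ, rfl⟩ := hA
  exact ⟨0, ⟨le_rfl, dist_nonneg⟩, h0⟩

theorem IsGeodesicSegment.right_mem {x y : S} {A : Set S} (hA : IsGeodesicSegment x y A) :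
    y ∈ A := by
  obtain ⟨γ, h0, h1, hγ, rfl⟩ := hA
  exact ⟨_, ⟨dist_nonneg, le_rfl⟩, h1⟩

theorem IsGeodesicSegment.gromovProduct_le_dist {x y q : S} {A : Set S}
    (hA : IsGeodesicSegment x y A) (hq : q ∈ A) (s : S) : gromovProduct s x y ≤ dist s q := by
  have h := hA.dist_add_dist hq
  have h₁ := dist_triangle_right x s q
  have h₂ := dist_triangle_right y s q
  rw [dist_comm q y] at h
  simp only [gromovProduct]
  linarith

/-- A geodesic segment from `x` to `y` comes close to `s` at distance about `(x, y)_s`. -/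
theorem IsGeodesicSegment.exists_dist_le_gromovProduct {δ : ℝ} (hS : IsHyperbolicSpace S)
    (hδ : HasSlimTriangles S δ) {x y : S} {A : Set S} (hA : IsGeodesicSegment x y A) (s : S) :
    ∃ p ∈ A, dist s p ≤ gromovProduct s x y + 2 * (δ + 1) := by
  obtain ⟨B, hB⟩ := hS.geodesic y s
  obtain ⟨C, hC⟩ := hS.geodesic s x
  have hBne : B.Nonempty := ⟨_, hB.left_mem⟩
  have hCne : C.Nonempty := ⟨_, hC.left_mem⟩
  -- Every point of `A` is `δ`-close to `B` or to `C`; by the intermediate value theorem some point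
  -- is equally far from both. The extra `1` makes the bound strict, so that actual nearby points
  -- `q` and `r` exist.
  obtain ⟨p, hp, hpB, hpC⟩ : ∃ p ∈ A, Metric.infDist p B < δ + 1 ∧ Metric.infDist p C < δ + 1 := by
    obtain ⟨γ, h0, h1, hγ, rfl⟩ := id hA
    have hcont : ContinuousOn γ (Set.Icc 0 (dist x y)) := by
      refine (LipschitzOnWith.of_dist_le_mul (K := 1) fun a ha b hb => ?_).continuousOn
      rw [hγ a ha b hb, NNReal.coe_one, one_mul, Real.dist_eq]
    have hf : ContinuousOn (fun t => Metric.infDist (γ t) C - Metric.infDist (γ t) B)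
        (Set.Icc 0 (dist x y)) :=
      ((Metric.continuous_infDist_pt C).comp_continuousOn hcont).sub
        ((Metric.continuous_infDist_pt B).comp_continuousOn hcont)
    have hmem : (0 : ℝ) ∈ Set.Icc (Metric.infDist (γ 0) C - Metric.infDist (γ 0) B)
        (Metric.infDist (γ (dist x y)) C - Metric.infDist (γ (dist x y)) B) := by
      rw [h0, h1, Metric.infDist_zero_of_mem hC.right_mem, Metric.infDist_zero_of_mem hB.left_mem]
      simp [Metric.infDist_nonneg]
    obtain ⟨t, ht, hft⟩ := intermediate_value_Icc dist_nonneg hf hmem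
    have heq : Metric.infDist (γ t) C = Metric.infDist (γ t) B := sub_eq_zero.1 hft
    refine ⟨γ t, ⟨t, ht, rfl⟩, ?_⟩
    obtain ⟨q, hq | hq, hdq⟩ := hδ x y s _ B C hA hB hC _ ⟨t, ht, rfl⟩
    · have := (Metric.infDist_le_dist_of_mem hq).trans hdq
      exact ⟨by linarith, by linarith⟩
    · have := (Metric.infDist_le_dist_of_mem hq).trans hdq
      exact ⟨by linarith, by linarith⟩
  obtain ⟨q, hq, hpq⟩ := (Metric.infDist_lt_iff hBne).1 hpB
  obtain ⟨r, hr, hpr⟩ := (Metric.infDist_lt_iff hCne).1 hpC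
  refine ⟨p, hp, ?_⟩
  have e₁ := hA.dist_add_dist hp
  have e₂ := hB.dist_add_dist hq
  have e₃ := hC.dist_add_dist hr
  have t₁ := dist_triangle_right p y q
  have t₂ := dist_triangle p q s
  have t₃ := dist_triangle p r x
  have t₄ := dist_triangle p r s
  simp only [gromovProduct]
  rw [dist_comm s r] at e₃
  rw [dist_comm x p] at e₁
  rw [dist_comm s p, dist_comm x s]
  linarith

/-- The side `[x, z]` passes within `(x, z)_s + 2(δ + 1)` of `s`. Slimness costs another `δ` to
reach one of the other sides, whose distance from `s` is at least the corresponding Gromov product.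
-/
theorem IsHyperbolicSpace.exists_isGromovHyperbolic (hS : IsHyperbolicSpace S) :
    ∃ δ : ℝ, IsGromovHyperbolic S δ := by
  obtain ⟨δ, h0, hδ⟩ := hS.slim
  refine ⟨3 * δ + 2, by positivity, fun s x y z => ?_⟩
  obtain ⟨A, hA⟩ := hS.geodesic x z
  obtain ⟨B, hB⟩ := hS.geodesic z y
  obtain ⟨C, hC⟩ := hS.geodesic y x
  obtain ⟨p, hp, hsp⟩ := hA.exists_dist_le_gromovProduct hS hδ s
  obtain ⟨q, hq | hq, hpq⟩ := hδ x z y A B C hA hB hC p hp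
  · have h₁ := hB.gromovProduct_le_dist hq s
    rw [gromovProduct_comm] at h₁
    have h₂ := dist_triangle s p q
    have h₃ := min_le_right (gromovProduct s x y) (gromovProduct s y z)
    linarith
  · have h₁ := hC.gromovProduct_le_dist hq s
    rw [gromovProduct_comm] at h₁
    have h₂ := dist_triangle s p q
    have h₃ := min_le_left (gromovProduct s x y) (gromovProduct s y z)
    linarith

/-! ### Sequences converging at infinity -/

theorem AsymptoticSeq.exists_forall_le {x y : ℕ → S} (h : AsymptoticSeq x y) (s : S) (R : ℝ) :
    ∃ N, ∀ i ≥ N, ∀ j ≥ N, R ≤ gromovProduct s (x i) (y j) := by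
  obtain ⟨⟨a, b⟩, hab⟩ := eventually_atTop.1 ((h s).eventually_ge_atTop R)
  exact ⟨max a b, fun i hi j hj =>
    hab (i, j) ⟨(le_max_left a b).trans hi, (le_max_right a b).trans hj⟩⟩

theorem asymptoticSeq_of_forall_exists {x y : ℕ → S} (s : S)
    (h : ∀ R : ℝ, ∃ N, ∀ i ≥ N, ∀ j ≥ N, R ≤ gromovProduct s (x i) (y j)) :
    AsymptoticSeq x y := by
  intro t
  refine tendsto_atTop.2 fun R => ?_
  obtain ⟨N, hN⟩ := h (R + dist s t)
  refine eventually_atTop.2 ⟨(N, N), fun p hp => ?_⟩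
  have := hN p.1 hp.1 p.2 hp.2
  have := gromovProduct_le_add_base s t (x p.1) (y p.2)
  linarith

theorem AsymptoticSeq.symm {x y : ℕ → S} (h : AsymptoticSeq x y) : AsymptoticSeq y x :=
  asymptoticSeq_of_forall_exists (x 0) fun R => by
    obtain ⟨N, hN⟩ := h.exists_forall_le (x 0) R
    exact ⟨N, fun i hi j hj => by simpa only [gromovProduct_comm] using hN j hj i hi⟩

theorem AsymptoticSeq.trans {δ : ℝ} (hδ : IsGromovHyperbolic S δ) {x y z : ℕ → S}
    (h₁ : AsymptoticSeq x y) (h₂ : AsymptoticSeq y z) : AsymptoticSeq x z :=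
  asymptoticSeq_of_forall_exists (x 0) fun R => by
    obtain ⟨N, hN⟩ := h₁.exists_forall_le (x 0) (R + δ)
    obtain ⟨M, hM⟩ := h₂.exists_forall_le (x 0) (R + δ)
    refine ⟨max N M, fun i hi j hj => ?_⟩
    have := hδ.le_trans (hN i ((le_max_left _ _).trans hi) (max N M) (le_max_left _ _))
      (hM (max N M) (le_max_right _ _) j ((le_max_right _ _).trans hj))
    linarith

theorem boundary_mk_eq_iff {δ : ℝ} (hδ : IsGromovHyperbolic S δ) (x y : SeqAtInfinity S) :
    (Quot.mk _ x : GromovBoundary S) = Quot.mk _ y ↔ AsymptoticSeq x.1 y.1 := by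
  refine ⟨fun h => ?_, fun h => Quot.sound h⟩
  have hgen := Quot.eqvGen_exact h
  clear h
  induction hgen with
  | rel _ _ h => exact h
  | refl a => exact a.2
  | symm _ _ _ ih => exact ih.symm
  | trans _ _ _ _ _ ih₁ ih₂ => exact ih₁.trans hδ ih₂

theorem GromovBoundary.exists_rep (ξ : GromovBoundary S) :
    ∃ x : ℕ → S, ConvergesToBoundary x ξ := by
  obtain ⟨x, rfl⟩ := Quot.exists_rep ξ
  exact ⟨x.1, x.2, rfl⟩

theorem ConvergesToBoundary.eq_iff {δ : ℝ} (hδ : IsGromovHyperbolic S δ) {x y : ℕ → S}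
    {ξ η : GromovBoundary S} (hx : ConvergesToBoundary x ξ) (hy : ConvergesToBoundary y η) :
    ξ = η ↔ AsymptoticSeq x y := by
  obtain ⟨hx, rfl⟩ := hx
  obtain ⟨hy, rfl⟩ := hy
  exact boundary_mk_eq_iff hδ _ _

theorem ConvergesToBoundary.congr {δ : ℝ} (hδ : IsGromovHyperbolic S δ) {x y : ℕ → S}
    {ξ : GromovBoundary S} (hx : ConvergesToBoundary x ξ) (h : AsymptoticSeq x y) :
    ConvergesToBoundary y ξ := by
  have hy : AsymptoticSeq y y := h.symm.trans hδ h
  exact ⟨hy, (ConvergesToBoundary.eq_iff hδ ⟨hy, rfl⟩ hx).2 h.symm⟩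

/-- The point `p` has Gromov product at least `R` with almost all terms of the sequence `x`. -/
def Near (s : S) (x : ℕ → S) (R : ℝ) (p : S) : Prop :=
  ∀ᶠ i in atTop, R ≤ gromovProduct s p (x i)

theorem Near.mono {s : S} {x : ℕ → S} {R R' : ℝ} {p : S} (h : Near s x R p) (hR : R' ≤ R) :
    Near s x R' p :=
  Eventually.mono h fun _ hi => hR.trans hi

theorem Near.le_dist {s : S} {x : ℕ → S} {R : ℝ} {p : S} (h : Near s x R p) : R ≤ dist s p := by
  obtain ⟨i, hi⟩ := Eventually.exists h
  exact hi.trans (gromovProduct_le_dist_left _ _ _)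

theorem Near.of_le_gromovProduct {δ : ℝ} (hδ : IsGromovHyperbolic S δ) {s : S} {x : ℕ → S}
    {R : ℝ} {p q : S} (h : Near s x R p) (hq : R ≤ gromovProduct s p q) :
    Near s x (R - δ) q :=
  Eventually.mono h fun _ hi => hδ.le_trans (by rwa [gromovProduct_comm]) hi

theorem AsymptoticSeq.eventually_near {x y : ℕ → S} (h : AsymptoticSeq x y) (s : S) (R : ℝ) :
    ∀ᶠ i in atTop, Near s y R (x i) := by
  obtain ⟨N, hN⟩ := h.exists_forall_le s R
  exact eventually_atTop.2 ⟨N, fun i hi => eventually_atTop.2 ⟨N, fun j hj => hN i hi j hj⟩⟩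

/-- Points close to inequivalent sequences have bounded Gromov product. -/
theorem exists_gromovProduct_le_of_near {δ : ℝ} (hδ : IsGromovHyperbolic S δ) (s : S)
    {x y : ℕ → S} (h : ¬ AsymptoticSeq x y) :
    ∃ K : ℝ, 0 ≤ K ∧ ∀ p q, Near s x K p → Near s y K q → gromovProduct s p q ≤ K := by
  by_contra! hcon
  refine h (asymptoticSeq_of_forall_exists s fun R => ?_)
  -- The four-point condition is then applied twice along the chain `x i`, `p`, `q`, `y j`.
  obtain ⟨p, q, hp, hq, hpq⟩ := hcon (max (R + 4 * δ) 0) (le_max_right _ _)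
  have hR := le_max_left (R + 4 * δ) 0
  have h0 := hδ.nonneg
  obtain ⟨N, hN⟩ := eventually_atTop.1 hp
  obtain ⟨M, hM⟩ := eventually_atTop.1 hq
  refine ⟨max N M, fun i hi j hj => ?_⟩
  have h₁ := hN i ((le_max_left _ _).trans hi)
  have h₂ := hM j ((le_max_right _ _).trans hj)
  rw [gromovProduct_comm] at h₁
  have h₃ := hδ.le_trans (R := R + 4 * δ) (hR.trans h₁) (hR.trans hpq.le)
  have h₄ := hδ.le_trans (R := R + 3 * δ) (by linarith)
    (show R + 3 * δ ≤ _ by linarith [hR.trans h₂])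
  linarith

/-- A single large product of `p` with a late `z j` would propagate to all late `x i`. -/
theorem not_near_eventually_le {δ : ℝ} (hδ : IsGromovHyperbolic S δ) {s p : S} {x z : ℕ → S}
    {R : ℝ} (h : ¬ Near s x R p) (hzx : AsymptoticSeq z x) :
    ∀ᶠ j in atTop, gromovProduct s p (z j) ≤ R + δ := by
  obtain ⟨N, hN⟩ := hzx.exists_forall_le s (R + δ)
  refine eventually_atTop.2 ⟨N, fun j hj => ?_⟩
  by_contra! hlt
  refine h (eventually_atTop.2 ⟨N, fun i hi => ?_⟩)
  have := hδ.le_trans hlt.le (hN j hj i hi)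
  linarith

theorem asymptoticSeq_of_near {δ : ℝ} (hδ : IsGromovHyperbolic S δ) {s : S} {x z : ℕ → S}
    (hx : AsymptoticSeq x x) (C : ℝ) (h : ∀ n : ℕ, Near s x (n - C) (z n)) :
    AsymptoticSeq x z := by
  refine asymptoticSeq_of_forall_exists s fun R => ?_
  obtain ⟨N, hN⟩ := hx.exists_forall_le s (R + δ)
  obtain ⟨M, hM⟩ := exists_nat_ge (R + δ + C)
  refine ⟨max N M, fun i hi j hj => ?_⟩
  obtain ⟨k, hk, hkN⟩ := ((h j).and (eventually_ge_atTop N)).exists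
  have hjM : (M : ℝ) ≤ j := by exact_mod_cast (le_max_right N M).trans hj
  rw [gromovProduct_comm] at hk
  have := hδ.le_trans (hN i ((le_max_left _ _).trans hi) k hkN) (show R + δ ≤ _ by linarith)
  linarith

theorem AsymptoticSeq.of_dist_le {x y z : ℕ → S} {C : ℝ} (h : AsymptoticSeq x y)
    (hyz : ∀ n, dist (y n) (z n) ≤ C) : AsymptoticSeq x z :=
  asymptoticSeq_of_forall_exists (x 0) fun R => by
    obtain ⟨N, hN⟩ := h.exists_forall_le (x 0) (R + C)
    refine ⟨N, fun i hi j hj => ?_⟩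
    have := hN i hi j hj
    have := gromovProduct_le_add_right (x 0) (x i) (y j) (z j)
    have := hyz j
    linarith

/-! ### The closure of a subset of the space in the bordification -/

theorem AsymptoticSeq.near {δ : ℝ} (hδ : IsGromovHyperbolic S δ) {s p : S} {x y : ℕ → S} {R : ℝ}
    (h : AsymptoticSeq x y) (hp : Near s x R p) : Near s y (R - δ) p := by
  obtain ⟨N, hN⟩ := h.exists_forall_le s R
  obtain ⟨i, hi, hiN⟩ := (Eventually.and hp (eventually_ge_atTop N)).exists
  exact eventually_atTop.2 ⟨N, fun j hj => hδ.le_trans hi (hN i hiN j hj)⟩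

/-- A boundary point is in the closure of a set `A` of points of `S` if and only if it is the
limit of a sequence in `A`. -/
theorem ofBoundary_mem_closure_iff {δ : ℝ} (hδ : IsGromovHyperbolic S δ) (A : Set S)
    (ξ : GromovBoundary S) :
    ofBoundary ξ ∈ closure (ofPoint '' A) ↔
      ∃ a : ℕ → S, (∀ n, a n ∈ A) ∧ ConvergesToBoundary a ξ := by
  constructor
  · intro hξ
    by_contra hcon
    -- The complement of `closure A` together with all limits of sequences in `A`. Once shown open,
    -- it is a neighbourhood of `ξ` missing `A`.
    let U : Set (Bordification S) := {p | (∀ y, p = ofPoint y → y ∉ closure A) ∧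
      ∀ η, p = ofBoundary η → ¬ ∃ a : ℕ → S, (∀ n, a n ∈ A) ∧ ConvergesToBoundary a η}
    have hU : IsOpen U := by
      constructor
      · have : ofPoint ⁻¹' U = (closure A)ᶜ := by
          ext y
          refine ⟨fun h => h.1 y rfl, fun h => ⟨fun z hz => ?_, fun η hη => ?_⟩⟩
          · cases hz
            exact h
          · cases hη
        rw [this]
        exact isClosed_closure.isOpen_compl
      · intro η hη s
        by_contra! hR
        obtain ⟨x, hx⟩ := η.exists_rep
        -- Points outside `U` accumulate at `η`, and each is approximated by points of `A`; a
        -- diagonal choice gives a sequence in `A` tending to `η`. The loss `2 * δ + 2` covers both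
        -- kinds of point.
        have key : ∀ n : ℕ, ∃ a ∈ A, Near s x (n - (2 * δ + 2)) a := by
          intro n
          have h0 := hδ.nonneg
          obtain ⟨p, ⟨x', y, hx', hy, hxy⟩, hpU⟩ := Set.not_subset.1 (hR n)
          have hxx : AsymptoticSeq x' x := (hx'.eq_iff hδ hx).1 rfl
          obtain ⟨⟨N₁, N₂⟩, hN⟩ := eventually_atTop.1 hxy
          have hnear : ∀ j ≥ N₂, Near s x (n - δ) (y j) := fun j hj =>
            hxx.near hδ (eventually_atTop.2 ⟨N₁, fun i hi => by
              rw [gromovProduct_comm]; exact hN (i, j) ⟨hi, hj⟩⟩)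
          rcases p with p | ζ
          · have hpA : p ∈ closure A := by
              by_contra hpA
              refine hpU ⟨fun z hz => ?_, fun η hη => ?_⟩
              · cases hz
                exact hpA
              · cases hη
            obtain ⟨a, haA, hpa⟩ := Metric.mem_closure_iff.1 hpA 1 one_pos
            obtain ⟨j, hj, hjN⟩ := ((Metric.tendsto_nhds.1 (show Tendsto y atTop (𝓝 p) from hy) 1
              one_pos).and (eventually_ge_atTop N₂)).exists
            refine ⟨a, haA, Eventually.mono (hnear j hjN) fun i hi => ?_⟩
            have h₁ := gromovProduct_le_add_right s (x i) (y j) a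
            have h₂ := dist_triangle (y j) p a
            rw [gromovProduct_comm, gromovProduct_comm s (x i) a] at h₁
            linarith
          · have hζ : ∃ a : ℕ → S, (∀ n, a n ∈ A) ∧ ConvergesToBoundary a ζ := by
              by_contra hζ
              refine hpU ⟨fun z hz => ?_, fun η hη => ?_⟩
              · cases hz
              · cases hη
                exact hζ
            obtain ⟨a, haA, ha⟩ := hζ
            have hya : AsymptoticSeq y a :=
              (ConvergesToBoundary.eq_iff hδ (show ConvergesToBoundary y ζ from hy) ha).1 rfl
            obtain ⟨M, hM⟩ := hya.exists_forall_le s (n - δ)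
            refine ⟨a (max N₂ M), haA _, ((hnear (max N₂ M) (le_max_left _ _)).of_le_gromovProduct
              hδ (hM _ (le_max_right _ _) _ (le_max_right _ _))).mono (by linarith)⟩
        choose a haA ha using key
        exact hη.2 η rfl ⟨a, haA, hx.congr hδ (asymptoticSeq_of_near hδ hx.1 _ ha)⟩
    have hξU : ofBoundary ξ ∈ U := by
      refine ⟨fun z hz => ?_, fun η hη => ?_⟩
      · cases hz
      · cases hη
        exact hcon
    obtain ⟨_, hpU, y, hy, rfl⟩ := mem_closure_iff.1 hξ U hU hξU
    exact hpU.1 y rfl (subset_closure hy)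
  · rintro ⟨a, haA, ha⟩
    refine mem_closure_iff.2 fun U hU hξU => ?_
    obtain ⟨R, hR⟩ := hU.2 ξ hξU (a 0)
    obtain ⟨N, hN⟩ := ha.1.exists_forall_le (a 0) R
    refine ⟨ofPoint (a N), hR ⟨a, fun _ => a N, ha, tendsto_const_nhds, ?_⟩, a N, haA N, rfl⟩
    exact eventually_atTop.2 ⟨(N, N), fun p hp => hN p.1 hp.1 N le_rfl⟩

end Hyperbolic

section Action

variable {G : Type*} [Group G] {S : Type*} [MetricSpace S] [MulAction G S] [IsIsometricSMul G S]

theorem gromovProduct_smul (g : G) (s x y : S) :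
    gromovProduct (g • s) (g • x) (g • y) = gromovProduct s x y := by
  simp only [gromovProduct, dist_smul]

theorem dist_inv_smul_self (g : G) (s : S) : dist s (g⁻¹ • s) = dist s (g • s) := by
  rw [← dist_smul g s (g⁻¹ • s), smul_inv_smul, dist_comm]

/-- `(gx, gs)_s = d(s, gs) - (x, g⁻¹s)_s`. -/
theorem gromovProduct_smul_smul (g : G) (s x : S) :
    gromovProduct s (g • s) (g • x) = dist s (g • s) - gromovProduct s (g⁻¹ • s) x := by
  have h := gromovProduct_add s (g • s) (g • x)
  rw [← gromovProduct_smul g⁻¹ (g • s) s (g • x), inv_smul_smul, inv_smul_smul] at h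
  linarith

theorem Near.smul {s : S} {x : ℕ → S} {R R' : ℝ} {p : S} (g : G) (h : Near s x R p)
    (hR : R' + dist s (g • s) ≤ R) : Near s (fun i => g • x i) R' (g • p) :=
  Eventually.mono h fun i hi => by
    have := gromovProduct_le_add_base (g • s) s (g • p) (g • x i)
    rw [gromovProduct_smul, dist_comm] at this
    linarith

theorem ConvergesToBoundary.smul {x : ℕ → S} {ξ : GromovBoundary S} (g : G)
    (h : ConvergesToBoundary x ξ) : ConvergesToBoundary (fun i => g • x i) (g • ξ) := by
  obtain ⟨hx, rfl⟩ := h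
  exact ⟨hx.smul g, rfl⟩

/-! ### Limit sets -/

/-- Orbits of two base points stay at bounded distance from each other, so any `s` serves. -/
theorem mem_limitSet_iff {δ : ℝ} (hδ : IsGromovHyperbolic S δ) (s : S) (ξ : GromovBoundary S) :
    ξ ∈ limitSet G S ↔ ∃ a : ℕ → G, ConvergesToBoundary (fun n => a n • s) ξ := by
  constructor
  · rintro ⟨t, ht⟩
    obtain ⟨y, hy, hyξ⟩ := (ofBoundary_mem_closure_iff hδ _ ξ).1 ht
    choose a ha using hy
    refine ⟨a, hyξ.congr hδ (hyξ.1.of_dist_le (C := dist t s) fun n => ?_)⟩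
    rw [← ha n]
    exact (dist_smul (a n) t s).le
  · rintro ⟨a, ha⟩
    exact ⟨s, (ofBoundary_mem_closure_iff hδ _ ξ).2 ⟨_, fun n => ⟨a n, rfl⟩, ha⟩⟩

theorem limitSet_subgroup_subset {δ : ℝ} (hδ : IsGromovHyperbolic S δ) (H : Subgroup G) :
    limitSet H S ⊆ limitSet G S := by
  intro ξ hξ
  obtain ⟨s, -⟩ := id hξ
  obtain ⟨a, ha⟩ := (mem_limitSet_iff hδ s ξ).1 hξ
  exact (mem_limitSet_iff hδ s ξ).2 ⟨fun n => a n, ha⟩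

theorem smul_mem_limitSet {δ : ℝ} (hδ : IsGromovHyperbolic S δ) (g : G) {ξ : GromovBoundary S}
    (hξ : ξ ∈ limitSet G S) : g • ξ ∈ limitSet G S := by
  obtain ⟨s, -⟩ := id hξ
  obtain ⟨a, ha⟩ := (mem_limitSet_iff hδ s ξ).1 hξ
  refine (mem_limitSet_iff hδ s _).2 ⟨fun n => g * a n, ?_⟩
  simpa only [mul_smul] using ha.smul g

theorem mem_limitSet_of_near {δ : ℝ} (hδ : IsGromovHyperbolic S δ) {s : S} {x : ℕ → S}
    {ξ : GromovBoundary S} (hx : ConvergesToBoundary x ξ)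
    (h : ∀ R : ℝ, ∃ g : G, Near s x R (g • s)) : ξ ∈ limitSet G S := by
  -- The `- 0` is the constant `C = 0` of `asymptoticSeq_of_near`.
  choose a ha using fun n : ℕ => h (n - 0)
  exact (mem_limitSet_iff hδ s ξ).2 ⟨a, hx.congr hδ (asymptoticSeq_of_near hδ hx.1 0 ha)⟩

theorem exists_near_of_mem_limitSet {δ : ℝ} (hδ : IsGromovHyperbolic S δ) (s : S) {x : ℕ → S}
    {ξ : GromovBoundary S} (hx : ConvergesToBoundary x ξ) (hξ : ξ ∈ limitSet G S) (R : ℝ) :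
    ∃ g : G, Near s x R (g • s) := by
  obtain ⟨a, ha⟩ := (mem_limitSet_iff hδ s ξ).1 hξ
  obtain ⟨i, hi⟩ := (((ha.eq_iff hδ hx).1 rfl).eventually_near s R).exists
  exact ⟨a i, hi⟩

/-! ### Loxodromic elements -/

/-- A quantitative sufficient condition for `g` to be loxodromic: the orbit map
`n ↦ gⁿs` makes long steps with little backtracking. -/
structure HasLongSteps (δ : ℝ) (g : G) (s : S) (c : ℝ) : Prop where
  le : gromovProduct s (g • s) (g⁻¹ • s) ≤ c
  lt : 2 * c + 3 * δ < dist s (g • s)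

namespace HasLongSteps

variable {δ : ℝ} {g : G} {s : S} {c : ℝ}

theorem inv (h : HasLongSteps δ g s c) : HasLongSteps δ g⁻¹ s c where
  le := by
    rw [inv_inv, gromovProduct_comm]
    exact h.le
  lt := by
    rw [dist_inv_smul_self]
    exact h.lt

theorem gromovProduct_le (h : HasLongSteps δ g s c) (hδ : IsGromovHyperbolic S δ) (n : ℕ) :
    gromovProduct s (g⁻¹ • s) (g ^ n • s) ≤ c + δ := by
  have h0 := hδ.nonneg
  have hc := (gromovProduct_nonneg _ _ _).trans h.le
  induction n with
  | zero =>
    rw [pow_zero, one_smul]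
    have := gromovProduct_le_dist_right s (g⁻¹ • s) s
    rw [dist_self] at this
    linarith
  | succ n ih =>
    have h₁ := gromovProduct_smul_smul g s (g ^ n • s)
    rw [← mul_smul, ← pow_succ'] at h₁
    have h₂ := h.lt
    have h₃ := h.le
    by_contra! hlt
    -- `gⁿ⁺¹s` lies in the direction of `gs`; were it also in that of `g⁻¹s`, these two directions
    -- would have product above `c`.
    have h₄ := hδ.le_trans (R := min (gromovProduct s (g • s) (g ^ (n + 1) • s))
      (gromovProduct s (g⁻¹ • s) (g ^ (n + 1) • s))) (min_le_left _ _)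
      ((min_le_right _ _).trans_eq (gromovProduct_comm s (g⁻¹ • s) _))
    rcases min_cases (gromovProduct s (g • s) (g ^ (n + 1) • s))
      (gromovProduct s (g⁻¹ • s) (g ^ (n + 1) • s)) with h₅ | h₅ <;> linarith

theorem le_gromovProduct (h : HasLongSteps δ g s c) (hδ : IsGromovHyperbolic S δ) (n : ℕ) :
    dist s (g • s) - (c + δ) ≤ gromovProduct s (g • s) (g ^ (n + 1) • s) := by
  have h₁ := gromovProduct_smul_smul g s (g ^ n • s)
  rw [← mul_smul, ← pow_succ'] at h₁
  have := h.gromovProduct_le hδ n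
  linarith

theorem le_dist (h : HasLongSteps δ g s c) (hδ : IsGromovHyperbolic S δ) (n : ℕ) :
    n * (dist s (g • s) - 2 * (c + δ)) ≤ dist s (g ^ n • s) := by
  induction n with
  | zero => simp
  | succ n ih =>
    have h₁ := h.le_gromovProduct hδ n
    have h₂ : dist (g • s) (g ^ (n + 1) • s) = dist s (g ^ n • s) := by
      rw [pow_succ', mul_smul, dist_smul]
    simp only [gromovProduct, h₂, dist_comm _ s] at h₁
    push_cast
    linarith

/-- The same argument between backward and forward orbits; this is where the full `3 * δ` of
`HasLongSteps.lt` is used. -/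
theorem gromovProduct_pow_le (h : HasLongSteps δ g s c) (hδ : IsGromovHyperbolic S δ)
    (m n : ℕ) : gromovProduct s (g⁻¹ ^ m • s) (g ^ n • s) ≤ c + 2 * δ := by
  have h0 := hδ.nonneg
  have hc := (gromovProduct_nonneg _ _ _).trans h.le
  rcases m with _ | m
  · rw [pow_zero, one_smul]
    have := gromovProduct_le_dist_left s s (g ^ n • s)
    rw [dist_self] at this
    linarith
  · have h₁ := h.inv.le_gromovProduct hδ m
    rw [dist_inv_smul_self] at h₁
    have h₂ := h.gromovProduct_le hδ n
    have h₃ := h.lt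
    have h₄ := hδ.le_trans (R := min (gromovProduct s (g⁻¹ • s) (g⁻¹ ^ (m + 1) • s))
      (gromovProduct s (g⁻¹ ^ (m + 1) • s) (g ^ n • s))) (min_le_left _ _) (min_le_right _ _)
    rcases min_cases (gromovProduct s (g⁻¹ • s) (g⁻¹ ^ (m + 1) • s))
      (gromovProduct s (g⁻¹ ^ (m + 1) • s) (g ^ n • s)) with h₅ | h₅ <;> linarith

theorem le_gromovProduct_pow (h : HasLongSteps δ g s c) (hδ : IsGromovHyperbolic S δ)
    {m n : ℕ} (hmn : m ≤ n) :
    dist s (g ^ m • s) - (c + 2 * δ) ≤ gromovProduct s (g ^ m • s) (g ^ n • s) := by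
  obtain ⟨k, rfl⟩ := Nat.exists_eq_add_of_le hmn
  have h₁ := gromovProduct_smul_smul (g ^ m) s (g ^ k • s)
  rw [← inv_pow] at h₁
  have := h.gromovProduct_pow_le hδ m k
  rw [pow_add, mul_smul]
  linarith

theorem eventually_le_dist (h : HasLongSteps δ g s c) (hδ : IsGromovHyperbolic S δ) (R : ℝ) :
    ∀ᶠ n : ℕ in atTop, R ≤ dist s (g ^ n • s) := by
  have h0 := hδ.nonneg
  have hpos : 0 < dist s (g • s) - 2 * (c + δ) := by linarith [h.lt]
  exact ((tendsto_natCast_atTop_atTop.atTop_mul_const hpos).eventually_ge_atTop R).mono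
    fun n hn => hn.trans (h.le_dist hδ n)

theorem asymptoticSeq (h : HasLongSteps δ g s c) (hδ : IsGromovHyperbolic S δ) :
    AsymptoticSeq (fun n => g ^ n • s) (fun n => g ^ n • s) := by
  refine asymptoticSeq_of_forall_exists s fun R => ?_
  obtain ⟨N, hN⟩ := eventually_atTop.1 (h.eventually_le_dist hδ (R + (c + 2 * δ)))
  refine ⟨N, fun i hi j hj => ?_⟩
  rcases le_total i j with hij | hij
  · linarith [h.le_gromovProduct_pow hδ hij, hN i hi]
  · rw [gromovProduct_comm]
    linarith [h.le_gromovProduct_pow hδ hij, hN j hj]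

/-- All positive powers of `g` move `s` in the same direction as `g`. -/
theorem near_pow (h : HasLongSteps δ g s c) (hδ : IsGromovHyperbolic S δ) {x : ℕ → S} {R : ℝ}
    (hx : Near s x (R + c + 2 * δ) (g • s)) {n : ℕ} (hn : 1 ≤ n) : Near s x R (g ^ n • s) := by
  obtain ⟨n, rfl⟩ := Nat.exists_eq_add_of_le' hn
  have hR := hx.le_dist
  have h0 := hδ.nonneg
  have hc := (gromovProduct_nonneg _ _ _).trans h.le
  have h₁ := h.le_gromovProduct hδ n
  refine ((hx.mono (show R + δ ≤ _ by linarith)).of_le_gromovProduct hδ ?_).mono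
    (by linarith)
  linarith

end HasLongSteps

/-- A group with two distinct limit points contains a loxodromic element. -/
theorem exists_hasLongSteps {δ : ℝ} (hδ : IsGromovHyperbolic S δ) (s : S)
    {ξ η : GromovBoundary S} (hξ : ξ ∈ limitSet G S) (hη : η ∈ limitSet G S) (hne : ξ ≠ η) :
    ∃ (g : G) (c : ℝ), HasLongSteps δ g s c := by
  by_contra! hcon
  -- Without long steps, `gs` and `g⁻¹s` always point in nearly the same direction. With `as` near
  -- `ξ` and `bs` near `η`, this forces `abs` near `ξ` and `(ab)⁻¹s` near `η`, so `ab` makes long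
  -- steps after all.
  have hinv : ∀ g : G, dist s (g • s) ≤ 2 * gromovProduct s (g • s) (g⁻¹ • s) + 3 * δ :=
    fun g => not_lt.1 fun hlt => hcon g _ ⟨le_rfl, hlt⟩
  have h0 := hδ.nonneg
  obtain ⟨x, hx⟩ := ξ.exists_rep
  obtain ⟨y, hy⟩ := η.exists_rep
  obtain ⟨K, hK0, hK⟩ := exists_gromovProduct_le_of_near hδ s
    (fun h => hne ((hx.eq_iff hδ hy).2 h))
  set M : ℝ := 3 * K + 9 * δ + 1 with hM
  obtain ⟨a, ha⟩ := exists_near_of_mem_limitSet hδ s hx hξ M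
  obtain ⟨b, hb⟩ := exists_near_of_mem_limitSet hδ s hy hη M
  have ha' : Near s x K (a⁻¹ • s) := by
    refine ((ha.mono (show K + δ ≤ M by linarith)).of_le_gromovProduct hδ ?_).mono (by linarith)
    linarith [hinv a, ha.le_dist]
  have hab := hK _ _ ha' (hb.mono (by linarith))
  have h₁ : dist s (a • s) - K ≤ gromovProduct s (a • s) ((a * b) • s) := by
    rw [mul_smul, gromovProduct_smul_smul]
    linarith
  have h₂ : dist s (b • s) - K ≤ gromovProduct s (b⁻¹ • s) ((a * b)⁻¹ • s) := by
    rw [mul_inv_rev, mul_smul, gromovProduct_smul_smul, inv_inv, dist_inv_smul_self,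
      gromovProduct_comm]
    linarith
  have hb' : Near s y (K + δ) (b⁻¹ • s) := by
    refine ((hb.mono (show K + 2 * δ ≤ M by linarith)).of_le_gromovProduct hδ ?_).mono
      (by linarith)
    linarith [hinv b, hb.le_dist]
  refine hcon (a * b) K ⟨hK _ _ ?_ ?_, ?_⟩
  · refine ((ha.mono (show K + δ ≤ M by linarith)).of_le_gromovProduct hδ ?_).mono (by linarith)
    linarith [ha.le_dist]
  · refine (hb'.of_le_gromovProduct hδ ?_).mono (by linarith)
    linarith [hb.le_dist]
  · have := gromovProduct_le_dist_right s (a • s) ((a * b) • s)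
    linarith [ha.le_dist]

/-! ### Actions of general type -/

/-- Some `t` moves the limit of `x`, hence moves a whole neighbourhood of it away from itself. -/
theorem exists_gromovProduct_smul_le_of_near {δ : ℝ} (hδ : IsGromovHyperbolic S δ) (s : S)
    (hfix : ¬ ∃ ξ : GromovBoundary S, ∀ g : G, g • ξ = ξ) {x : ℕ → S} (hx : AsymptoticSeq x x) :
    ∃ (t : G) (K : ℝ), ∀ p, Near s x K p → gromovProduct s (t • p) p ≤ K := by
  push Not at hfix
  obtain ⟨t, ht⟩ := hfix (Quot.mk _ ⟨x, hx⟩)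
  have hx' : ConvergesToBoundary x (Quot.mk _ ⟨x, hx⟩) := ⟨hx, rfl⟩
  obtain ⟨K, hK0, hK⟩ := exists_gromovProduct_le_of_near hδ s
    (fun h => ht (((hx'.smul t).eq_iff hδ hx').2 h))
  have hd : 0 ≤ dist s (t • s) := dist_nonneg
  refine ⟨t, K + dist s (t • s), fun p hp => ?_⟩
  linarith [hK _ _ (hp.smul t le_rfl) (hp.mono (by linarith))]

/-- In an action of general type, the points of any pair can be separated, as seen from `s`, by
moving one of them by an element of bounded displacement. -/
theorem IsGeneralType.exists_gromovProduct_smul_le {δ : ℝ} (hδ : IsGromovHyperbolic S δ)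
    (hG : IsGeneralType G S) (s : S) :
    ∃ K : ℝ, ∀ x y : S, ∃ c : G, dist s (c • s) ≤ K ∧ gromovProduct s (c • x) y ≤ K := by
  have h0 := hδ.nonneg
  obtain ⟨ξ, hξ, η, hη, hne⟩ := hG.1.nontrivial
  obtain ⟨g, c, hg⟩ := exists_hasLongSteps hδ s hξ hη hne
  obtain ⟨t, K, hK⟩ := exists_gromovProduct_smul_le_of_near hδ s hG.2 (hg.asymptoticSeq hδ)
  obtain ⟨t', K', hK'⟩ := exists_gromovProduct_smul_le_of_near hδ s hG.2 (hg.inv.asymptoticSeq hδ)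
  set T : ℝ := max K K' + δ with hT
  have hKT := le_max_left K K'
  have hKT' := le_max_right K K'
  obtain ⟨N, hN, hNp, hNm⟩ := ((hg.eventually_le_dist hδ (2 * T + 2 * δ + 1)).and
    (((hg.asymptoticSeq hδ).eventually_near s T).and
      ((hg.inv.asymptoticSeq hδ).eventually_near s T))).exists
  obtain ⟨D, hD⟩ : ∃ D : ℝ, ∀ a ∈ ({1, g ^ N, t, t'} : Set G), dist s (a • s) ≤ D := by
    obtain ⟨D, hD⟩ := ((Set.toFinite ({1, g ^ N, t, t'} : Set G)).image
      fun a => dist s (a • s)).bddAbove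
    exact ⟨D, fun a ha => hD ⟨a, ha, rfl⟩⟩
  -- Near the attracting or repelling end of `g`, use `t` or `t'`; elsewhere `g ^ N` pushes `x`
  -- towards the attracting end, away from where it was.
  have key : ∀ x : S, ∃ a ∈ ({1, g ^ N, t, t'} : Set G),
      gromovProduct s (a • x) x ≤ T + δ := by
    intro x
    by_cases h₁ : T ≤ gromovProduct s (g ^ N • s) x
    · exact ⟨t, by simp, (hK x ((hNp.of_le_gromovProduct hδ h₁).mono (by linarith))).trans
        (by linarith)⟩
    by_cases h₂ : T ≤ gromovProduct s (g⁻¹ ^ N • s) x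
    · exact ⟨t', by simp, (hK' x ((hNm.of_le_gromovProduct hδ h₂).mono (by linarith))).trans
        (by linarith)⟩
    refine ⟨g ^ N, by simp, ?_⟩
    by_contra! hlt
    have h₃ := gromovProduct_smul_smul (g ^ N) s x
    rw [← inv_pow] at h₃
    have := hδ.le_trans (R := T + δ) (by linarith) hlt.le
    linarith
  refine ⟨max D (T + 2 * δ), fun x y => ?_⟩
  obtain ⟨a, ha, hax⟩ := key x
  by_cases h₁ : gromovProduct s x y ≤ T + 2 * δ
  · exact ⟨1, (hD 1 (by simp)).trans (le_max_left _ _), by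
      rw [one_smul]
      exact h₁.trans (le_max_right _ _)⟩
  -- Here `y` is in the direction of `x`, so `a • x`, being separated from `x`, is separated from
  -- `y`.
  · refine ⟨a, (hD a ha).trans (le_max_left _ _), le_trans ?_ (le_max_right _ _)⟩
    by_contra! h₂
    rw [gromovProduct_comm s x y] at h₁
    have h₃ := hδ.four_point s (a • x) y x
    have h₄ := lt_min h₂ (not_le.1 h₁)
    linarith

/-- For distinct limit points `ξ` and `η` there is an element all of whose positive powers move
`s` close to `ξ` and all of whose negative powers move `s` close to `η`. -/
theorem IsGeneralType.exists_near_pow {δ : ℝ} (hδ : IsGromovHyperbolic S δ)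
    (hG : IsGeneralType G S) (s : S) {x y : ℕ → S} {ξ η : GromovBoundary S}
    (hx : ConvergesToBoundary x ξ) (hy : ConvergesToBoundary y η)
    (hξ : ξ ∈ limitSet G S) (hη : η ∈ limitSet G S) (hne : ξ ≠ η) (R : ℝ) :
    ∃ g : G, ∀ n : ℕ, 1 ≤ n → Near s x R (g ^ n • s) ∧ Near s y R ((g ^ n)⁻¹ • s) := by
  have h0 := hδ.nonneg
  obtain ⟨K, hK0, hK⟩ := exists_gromovProduct_le_of_near hδ s
    (fun h => hne ((hx.eq_iff hδ hy).2 h))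
  obtain ⟨C, hC⟩ := hG.exists_gromovProduct_smul_le hδ s
  obtain ⟨M, hM₁, hM₂⟩ : ∃ M : ℝ, R + K + 2 * δ ≤ M ∧ 2 * K + 3 * δ + 1 ≤ M :=
    ⟨_, le_max_left _ _, le_max_right _ _⟩
  -- The element will be `b * c * a⁻¹`, with `c` preventing cancellation between `a⁻¹` and `b`. One
  -- `|C|` pays for the product bound, the other for the displacement of `c` when inverting.
  obtain ⟨a, ha⟩ := exists_near_of_mem_limitSet hδ s hy hη (M + δ + 2 * |C|)
  obtain ⟨b, hb⟩ := exists_near_of_mem_limitSet hδ s hx hξ (M + δ + 2 * |C|)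
  have hC' := le_abs_self C
  have hC0 := abs_nonneg C
  obtain ⟨c, hcs, hc⟩ := hC (a⁻¹ • s) (b⁻¹ • s)
  have hpos : Near s x M ((b * c * a⁻¹) • s) := by
    refine ((hb.mono (show M + δ ≤ _ by linarith)).of_le_gromovProduct hδ ?_).mono (by linarith)
    rw [mul_assoc, mul_smul, gromovProduct_smul_smul, gromovProduct_comm, mul_smul]
    linarith [hb.le_dist]
  have hneg : Near s y M ((b * c * a⁻¹)⁻¹ • s) := by
    refine ((ha.mono (show M + δ ≤ _ by linarith)).of_le_gromovProduct hδ ?_).mono (by linarith)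
    have h₁ := gromovProduct_le_add_base (c • s) s (c • a⁻¹ • s) (b⁻¹ • s)
    rw [← gromovProduct_smul c⁻¹ (c • s), inv_smul_smul, inv_smul_smul, dist_comm] at h₁
    rw [show (b * c * a⁻¹)⁻¹ = a * (c⁻¹ * b⁻¹) by group, mul_smul, gromovProduct_smul_smul,
      mul_smul]
    linarith [ha.le_dist]
  have hlong : HasLongSteps δ (b * c * a⁻¹) s K :=
    ⟨hK _ _ (hpos.mono (by linarith)) (hneg.mono (by linarith)), by linarith [hpos.le_dist]⟩
  refine ⟨b * c * a⁻¹, fun n hn => ⟨hlong.near_pow hδ (hpos.mono hM₁) hn, ?_⟩⟩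
  rw [← inv_pow]
  exact hlong.inv.near_pow hδ (hneg.mono hM₁) hn

/-! ### Recurrent subgroups -/

theorem IsRecurrentSubgroup.exists_conj_mem {H : Subgroup G} (hH : IsRecurrentSubgroup H) {h : G}
    (hh : h ∈ H) (g : G) : ∃ n : ℕ, 1 ≤ n ∧ (g ^ n)⁻¹ * h * g ^ n ∈ H := by
  classical
  have hopen : IsOpen[subgroupTopology G] {K : Subgroup G | h ∈ K} := by
    have hcont : Continuous fun f : G → Bool => f h := continuous_apply h
    refine ⟨{f | f h = true}, hcont.isOpen_preimage {true} (isOpen_discrete _), ?_⟩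
    ext K
    simp
  -- Infinitely many return times give one with `n ≥ 1`; `n = 0` would only return `h`.
  obtain ⟨n, hn, hn1⟩ := (hH g _ hopen hh).exists_gt 0
  obtain ⟨k, hk, hkh⟩ := hn
  refine ⟨n, hn1, ?_⟩
  have : g ^ n * k * (g ^ n)⁻¹ = h := hkh
  rw [← this]
  simpa [mul_assoc] using hk

variable {δ : ℝ} {H : Subgroup G}

theorem limitSet_eq_of_isRecurrentSubgroup (hδ : IsGromovHyperbolic S δ) (hG : IsGeneralType G S)
    (hH : IsRecurrentSubgroup H) {h : G} (hh : h ∈ H) {ξ : GromovBoundary S}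
    (hξ : ξ ∈ limitSet G S) (hne : h • ξ ≠ ξ) : limitSet H S = limitSet G S := by
  refine (limitSet_subgroup_subset hδ H).antisymm fun η hη => ?_
  -- The attracting point must be moved by `h` and differ from the target `η`; if `ξ = η`, then `h •
  -- ξ` serves.
  obtain ⟨ζ, hζ, hζne, hζη⟩ : ∃ ζ ∈ limitSet G S, h • ζ ≠ ζ ∧ ζ ≠ η := by
    by_cases hξη : ξ = η
    · exact ⟨h • ξ, smul_mem_limitSet hδ h hξ, fun he => hne (smul_left_cancel h he),
        hξη ▸ hne⟩
    · exact ⟨ξ, hξ, hne, hξη⟩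
  obtain ⟨s, -⟩ := id hξ
  obtain ⟨x, hx⟩ := ζ.exists_rep
  obtain ⟨y, hy⟩ := η.exists_rep
  obtain ⟨K, hK0, hK⟩ := exists_gromovProduct_le_of_near hδ s
    (fun he => hζne (((hx.smul h).eq_iff hδ hx).2 he))
  refine mem_limitSet_of_near (s := s) hδ hy fun R => ?_
  have h0 := hδ.nonneg
  have hd : 0 ≤ dist s (h • s) := dist_nonneg
  obtain ⟨g, hg⟩ := hG.exists_near_pow hδ s hx hy hζ hη hζη (|R| + K + δ + dist s (h • s))
  obtain ⟨n, hn, hmem⟩ := hH.exists_conj_mem hh g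
  obtain ⟨hpos, hneg⟩ := hg n hn
  have hR := le_abs_self R
  have hR0 := abs_nonneg R
  have h₁ := hK (h • g ^ n • s) (g ^ n • s) (hpos.smul h (by linarith)) (hpos.mono (by linarith))
  refine ⟨⟨_, hmem⟩, ?_⟩
  change Near s y R (((g ^ n)⁻¹ * h * g ^ n) • s)
  refine ((hneg.mono (show R + δ ≤ _ by linarith)).of_le_gromovProduct hδ ?_).mono (by linarith)
  rw [mul_assoc, mul_smul, gromovProduct_smul_smul, inv_inv, gromovProduct_comm, mul_smul]
  linarith [hneg.le_dist]

theorem not_exists_fixed_of_isRecurrentSubgroup (hδ : IsGromovHyperbolic S δ)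
    (hG : IsGeneralType G S) (hH : IsRecurrentSubgroup H) {h : G} (hh : h ∈ H)
    {ξ : GromovBoundary S} (hξ : ξ ∈ limitSet G S) (hne : h • ξ ≠ ξ) :
    ¬ ∃ η : GromovBoundary S, ∀ k ∈ H, k • η = η := by
  rintro ⟨η, hη⟩
  -- `ζ ≠ ξ` is needed to choose `g`; `ζ ≠ η` ensures that `g ^ n` carries `η` close to `ξ`.
  obtain ⟨ζ, hζ, hζn⟩ := hG.1.exists_notMem_finite (Set.toFinite ({ξ, η} : Set (GromovBoundary S)))
  simp only [Set.mem_insert_iff, Set.mem_singleton_iff, not_or] at hζn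
  obtain ⟨s, -⟩ := id hξ
  obtain ⟨x, hx⟩ := ξ.exists_rep
  obtain ⟨y, hy⟩ := η.exists_rep
  obtain ⟨z, hz⟩ := ζ.exists_rep
  obtain ⟨K, hK0, hK⟩ := exists_gromovProduct_le_of_near hδ s
    (fun he => hne (((hx.smul h).eq_iff hδ hx).2 he))
  obtain ⟨C, hC0, hC⟩ := exists_gromovProduct_le_of_near hδ s
    (fun he => hζn.2 ((hz.eq_iff hδ hy).2 he))
  have h0 := hδ.nonneg
  have hd : 0 ≤ dist s (h • s) := dist_nonneg
  obtain ⟨g, hg⟩ := hG.exists_near_pow hδ s hx hz hξ hζ (Ne.symm hζn.1)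
    (K + C + δ + dist s (h • s))
  obtain ⟨n, hn, hmem⟩ := hH.exists_conj_mem hh g
  obtain ⟨hpos, hneg⟩ := hg n hn
  have hfix : h • g ^ n • η = g ^ n • η := by
    have := hη _ hmem
    rw [mul_smul, mul_smul, inv_smul_eq_iff] at this
    exact this
  have hgy := hy.smul (g ^ n)
  have hasym := ((hgy.smul h).eq_iff hδ hgy).1 hfix
  have hnear : ∀ᶠ j in atTop, Near s x (K + dist s (h • s)) (g ^ n • y j) := by
    filter_upwards [hy.1.eventually_near s C] with j hj
    have h₁ := hC _ _ (hneg.mono (by linarith)) hj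
    refine ((hpos.mono (show K + dist s (h • s) + δ ≤ _ by linarith)).of_le_gromovProduct hδ
      ?_).mono (by linarith)
    rw [gromovProduct_smul_smul]
    have := hneg.le_dist
    rw [dist_inv_smul_self] at this
    linarith
  obtain ⟨N, hN⟩ := hasym.exists_forall_le s (K + 1)
  obtain ⟨j, hj, hjN⟩ := (hnear.and (eventually_ge_atTop N)).exists
  -- `g ^ n • y j` is near `ξ` and its image under `h` near `h • ξ`, so their product is at most
  -- `K`; yet both sequences converge to the same point.
  have h₁ := hK _ _ (hj.smul h le_rfl) (hj.mono (by linarith))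
  linarith [hN j hjN j hjN]

/-! ### Ellipticity -/

/-- Isometries that fix three given distinct boundary points have uniformly bounded
displacement. -/
theorem exists_dist_smul_le_of_fixed (hδ : IsGromovHyperbolic S δ) (s : S)
    {ξ : Fin 3 → GromovBoundary S} (hξ : Function.Injective ξ) :
    ∃ C : ℝ, ∀ h : G, (∀ i, h • ξ i = ξ i) → dist s (h • s) ≤ C := by
  choose x hx using fun i => (ξ i).exists_rep
  have hsep : ∀ p : Fin 3 × Fin 3, p.1 ≠ p.2 → ∃ K : ℝ, 0 ≤ K ∧
      ∀ q r, Near s (x p.1) K q → Near s (x p.2) K r → gromovProduct s q r ≤ K := fun p hp =>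
    exists_gromovProduct_le_of_near hδ s fun he => hp (hξ (((hx _).eq_iff hδ (hx _)).2 he))
  have hsep' : ∀ p : Fin 3 × Fin 3, ∃ K : ℝ, p.1 ≠ p.2 →
      ∀ q, Near s (x p.1) K q → Near s (x p.2) K q → dist s q ≤ K := by
    intro p
    by_cases hp : p.1 = p.2
    · exact ⟨0, fun h => absurd hp h⟩
    · obtain ⟨K, -, hK⟩ := hsep p hp
      exact ⟨K, fun _ q h₁ h₂ => gromovProduct_self s q ▸ hK q q h₁ h₂⟩
  choose K hK using hsep'
  obtain ⟨M, hM⟩ := (Set.finite_range K).bddAbove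
  have hKM : ∀ p, K p ≤ M := fun p => hM ⟨p, rfl⟩
  refine ⟨max M (2 * (M + δ)), fun h hfix => ?_⟩
  by_contra! hlt
  obtain ⟨hlt₁, hlt₂⟩ := max_lt_iff.1 hlt
  have honce : ∀ q, M < dist s q → ∀ i j, Near s (x i) M q → Near s (x j) M q → i = j := by
    intro q hq i j hi hj
    by_contra hij
    have := hK (i, j) hij q (hi.mono (hKM _)) (hj.mono (hKM _))
    linarith [hKM (i, j)]
  -- Each of `h • s` and `h⁻¹ • s` is near at most one of the three points, so one index is left
  -- over.
  obtain ⟨i, hi₁, hi₂⟩ : ∃ i, ¬ Near s (x i) M (h • s) ∧ ¬ Near s (x i) M (h⁻¹ • s) := by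
    by_contra! hcon
    have o₁ := honce _ hlt₁
    have o₂ := honce (h⁻¹ • s) (by rwa [dist_inv_smul_self])
    have c0 := hcon 0
    have c1 := hcon 1
    have c2 := hcon 2
    have a01 := o₁ 0 1
    have a02 := o₁ 0 2
    have a12 := o₁ 1 2
    have b01 := o₂ 0 1
    have b02 := o₂ 0 2
    have b12 := o₂ 1 2
    simp only [Fin.reduceEq, imp_false] at a01 a02 a12 b01 b02 b12
    tauto
  have hx' : AsymptoticSeq (fun j => h⁻¹ • x i j) (x i) :=
    (((hx i).smul h⁻¹).eq_iff hδ (hx i)).1 (by rw [inv_smul_eq_iff, hfix i])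
  obtain ⟨j, h₁, h₂⟩ := ((not_near_eventually_le hδ hi₁ (hx i).1).and
    (not_near_eventually_le hδ hi₂ hx')).exists
  -- The two products, each at most `M + δ`, add up to `dist s (h • s)`.
  have h₃ := gromovProduct_smul_smul h s (h⁻¹ • x i j)
  rw [smul_inv_smul] at h₃
  linarith

theorem isElliptic_of_le_ellipticRadical (hδ : IsGromovHyperbolic S δ) (hG : IsGeneralType G S)
    (hH : H ≤ ellipticRadical G S) : IsElliptic H S := by
  intro s
  obtain ⟨T, hT, hcard⟩ := hG.1.exists_subset_card_eq 3
  let e : Fin 3 ≃ T := (Finset.equivFinOfCardEq hcard).symm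
  obtain ⟨C, hC⟩ := exists_dist_smul_le_of_fixed (G := G) hδ s
    (ξ := fun i => (e i : GromovBoundary S)) (Subtype.val_injective.comp e.injective)
  refine (Metric.isBounded_iff_subset_closedBall s).2 ⟨C, ?_⟩
  rintro _ ⟨h, rfl⟩
  rw [Metric.mem_closedBall, dist_comm]
  exact hC h fun i => hH h.2 ⟨_, hT (e i).2⟩

theorem IsGeometricallyDense.isGeneralType (hG : IsGeneralType G S)
    (hH : IsGeometricallyDense S H) : IsGeneralType H S := by
  refine ⟨?_, ?_⟩
  · rw [IsNonElementary, hH.2]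
    exact hG.1
  · rintro ⟨ξ, hξ⟩
    refine hH.1 ⟨ξ, fun h hh => ?_⟩
    -- The boundary actions of `H` and of `G` agree definitionally on a class given by a sequence.
    obtain ⟨x, rfl⟩ := Quot.exists_rep ξ
    exact hξ ⟨h, hh⟩

end Action

end HypAction

theorem mainTheorem2 {G : Type*} [Group G] [Countable G]
    {S : Type*} [MetricSpace S] (hS : HypAction.IsHyperbolicSpace S)
    [MulAction G S] [IsIsometricSMul G S] (hG : HypAction.IsGeneralType G S)
    (H : Subgroup G) (hH : HypAction.IsRecurrentSubgroup H) :
    (HypAction.IsGeometricallyDense S H ∨ H ≤ HypAction.ellipticRadical G S) ∧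
    (HypAction.IsGeometricallyDense S H → HypAction.IsGeneralType H S) ∧
    (H ≤ HypAction.ellipticRadical G S → HypAction.IsElliptic H S) := by
  obtain ⟨δ, hδ⟩ := hS.exists_isGromovHyperbolic
  refine ⟨?_, fun h => h.isGeneralType hG, HypAction.isElliptic_of_le_ellipticRadical hδ hG⟩
  by_cases hE : H ≤ HypAction.ellipticRadical G S
  · exact Or.inr hE
  · left
    obtain ⟨h, hh, hhE⟩ := SetLike.not_le_iff_exists.1 hE
    obtain ⟨ξ, hξ, hne⟩ : ∃ ξ ∈ HypAction.limitSet G S, h • ξ ≠ ξ := by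
      by_contra! hcon
      exact hhE fun ξ => hcon ξ.1 ξ.2
    exact ⟨HypAction.not_exists_fixed_of_isRecurrentSubgroup hδ hG hH hh hξ hne,
      HypAction.limitSet_eq_of_isRecurrentSubgroup hδ hG hH hh hξ hne⟩
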